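/- Let $k\ge 1$ and $n\ge 0$ be integers. An assignment of $n$ balls to $k$ bins is a vector $\vec n=(n_1,\dots,n_k)\in\mathbb N^k$ (where $0\in\mathbb N$) with $\sum_i n_i=n$. Consider the process in which, in each round, one of the $k$ bins (possibly an empty one) is chosen uniformly at random, independently of past choices, and one ball is removed from it if it is non-empty. Let $X_{\vec n}$ be the number of balls remaining at the first round at which exactly one bin is non-empty (at round $0$ if this already holds initially; $X_{\vec 0}=0$ for the empty assignment), and let $f(\vec n)=\mathbb E[X_{\vec n}]$. Then the minimum of $f$ over all assignments of $n$ balls to $k$ bins is attained only by balanced assignments, that is, those with $|n_i-n_j|\le 1$ for all $i,j\in\{1,\dots,k\}$, and it is attained by every such assignment. The same holds for the expected number of balls remaining in the process in which, in each round, one ball is removed from a bin chosen uniformly at random among the non-empty bins, and which ends as soon as at most one bin is non-empty. -/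

import Mathlib

open MeasureTheory

noncomputable section

namespace BallsBins

/-- Remove one ball from bin `i` if that bin is non-empty; an empty bin stays empty
(subtraction on `ℕ` is truncated). -/
def removeBall {k : ℕ} (v : Fin k → ℕ) (i : Fin k) : Fin k → ℕ :=
  Function.update v i (v i - 1)

/-- The set of non-empty bins of an assignment. -/
def nonemptyBins {k : ℕ} (v : Fin k → ℕ) : Finset (Fin k) :=
  Finset.univ.filter fun i => v i ≠ 0

/-- The total number of balls of an assignment. -/
def total {k : ℕ} (v : Fin k → ℕ) : ℕ := ∑ i, v i

/-- All bins differ by at most one ball. -/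
def Balanced {k : ℕ} (v : Fin k → ℕ) : Prop :=
  ∀ i j, |(v i : ℤ) - (v j : ℤ)| ≤ 1

/-! ### The removal process driven by a sequence of uniformly chosen bins -/

/-- The law of an infinite sequence of independent, uniformly distributed choices of bins. -/
def choiceMeasure (k : ℕ) [NeZero k] : Measure (ℕ → Fin k) :=
  Measure.infinitePi fun _ : ℕ => (PMF.uniformOfFintype (Fin k)).toMeasure

/-- The assignment after `t` rounds, when `ω s` is the bin (possibly empty) chosen in round
`s + 1`, and a ball is removed from it if it is non-empty. -/
def state {k : ℕ} (v : Fin k → ℕ) (ω : ℕ → Fin k) : ℕ → Fin k → ℕ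
  | 0 => v
  | t + 1 => removeBall (state v ω t) (ω t)

/-- The first round at which there is a unique non-empty bin. If there is no such round
(which has probability zero unless there are no balls at all), the value is `0`. -/
def stopTime {k : ℕ} (v : Fin k → ℕ) (ω : ℕ → Fin k) : ℕ :=
  sInf {t | (nonemptyBins (state v ω t)).card = 1}

/-- The number of balls that remain when a unique non-empty bin is left. -/
def remaining {k : ℕ} (v : Fin k → ℕ) (ω : ℕ → Fin k) : ℕ :=
  total (state v ω (stopTime v ω))

/-- The expected number of remaining balls. -/
def f {k : ℕ} [NeZero k] (v : Fin k → ℕ) : ℝ :=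
  ∫ ω, (remaining v ω : ℝ) ∂(choiceMeasure k)

/-! ### The process that chooses only among the non-empty bins -/

/-- One round: if at least two bins are non-empty, one of the non-empty bins is chosen uniformly
at random and a ball is removed from it; otherwise the process has ended. -/
def step {k : ℕ} (v : Fin k → ℕ) : PMF (Fin k → ℕ) :=
  if h : 2 ≤ (nonemptyBins v).card then
    (PMF.uniformOfFinset (nonemptyBins v)
      (Finset.card_pos.mp (lt_of_lt_of_le Nat.zero_lt_two h))).map (removeBall v)
  else PMF.pure v

/-- The law of the assignment after `t` rounds, starting from a given one. -/
def law {k : ℕ} : ℕ → (Fin k → ℕ) → PMF (Fin k → ℕ)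
  | 0, v => PMF.pure v
  | t + 1, v => (step v).bind (law t)

/-- The expected number of balls at the end of the process. Every round before the end removes
one ball, so after `total v` rounds the process has ended. -/
def fNonempty {k : ℕ} (v : Fin k → ℕ) : ℝ :=
  ∫ w, (total w : ℝ) ∂(law (total v) v).toMeasure

end BallsBins

end

/-!
Let the bins lose balls at the events of independent rate one Poisson processes. The number of balls
left in the last non-empty bin is then, in expectation, the duration of the phase in which exactly
one bin is non-empty, so that both expectations equal
`lastPhase v = ∫₀^∞ ∑ l, tail (v l) t * ∏ m ≠ l, cdf (v m) t dt`, where `tail n t` and `cdf n t`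
are the probabilities that a bin with `n` balls is non-empty, respectively empty, at time `t`.
This identity is not proved by a coupling: integrating the Kolmogorov equation
`hasDerivAt_oneLeft` shows that `lastPhase` satisfies the first step equation
`k * X v = ∑ i, X (removeBall v i)` of the discrete process (`card_mul_lastPhase`). So do
`f` (by the shift structure of the sequence of choices, `map_consChoice`) and, after cancelling the
rounds that choose an empty bin, `fNonempty`; the equation and the values at assignments with at
most one non-empty bin determine a function (`eq_of_first_step`).

It remains to minimise `lastPhase`. Moving a ball from one bin to another with at least two balls
fewer does not always help, but it strictly does when the ball comes from a fullest bin
(`lastPhase_exchange_lt`). Let the fullest bin have `n + 1` balls and the receiving bin `a < n`,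
and write `p`, `F` and `q` for `poissonWeight`, `cdf` and `tail`. With `A` and `B` the probabilities
that none, respectively exactly one, of the other bins is non-empty, the integrand drops by
`A * (p a - p n) + (2 * A - B) * w` with `w = p n * F a - p a * F n ≥ 0`, which has no constant
sign. Add the derivative of `A * W`, where `W = q (n + 1) / p n * w` tends to zero at `0` and at
`∞`, so that the integral does not change. Since `c ↦ q c / p (c - 1)` is increasing and the other
bins have at most `n + 1` balls, `A' * W ≥ B * w`. The remaining factor of `A` equals
`p a * q n - p n * q a + q (n + 1) * F (n + 1) * (n - a) / t * p a / p n`, which is positive because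
`c ↦ q c / p c` is increasing (`exchangeGain_add_deriv_pos`).

Hence minimal assignments are balanced. Conversely, there is a minimal assignment, and all balanced
assignments with the same total are permutations of each other, on which `lastPhase` is constant.
-/

namespace BallsBins

open Filter Topology Set

/-! ### Gamma densities and distribution functions -/

/-- The Poisson weight `e⁻ᵗ tⁿ / n!`, which is also the density at `t` of the time at which a bin
with `n + 1` balls becomes empty, when balls are removed at the events of a rate one Poisson
process. -/
noncomputable def poissonWeight (n : ℕ) (t : ℝ) : ℝ := t ^ n / n.factorial * Real.exp (-t)

/-- The probability that a bin with `n` balls is still non-empty at time `t`. -/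
noncomputable def tail (n : ℕ) (t : ℝ) : ℝ := ∑ j ∈ Finset.range n, poissonWeight j t

/-- The probability that a bin with `n` balls is empty at time `t`. -/
noncomputable def cdf (n : ℕ) (t : ℝ) : ℝ := 1 - tail n t

lemma tail_zero (t : ℝ) : tail 0 t = 0 := by simp [tail]

lemma tail_succ (n : ℕ) (t : ℝ) : tail (n + 1) t = tail n t + poissonWeight n t := by
  simp [tail, Finset.sum_range_succ]

lemma cdf_zero (t : ℝ) : cdf 0 t = 1 := by simp [cdf, tail_zero]

lemma cdf_succ (n : ℕ) (t : ℝ) : cdf (n + 1) t = cdf n t - poissonWeight n t := by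
  simp only [cdf, tail_succ]; ring

lemma poissonWeight_pos (n : ℕ) {t : ℝ} (ht : 0 < t) : 0 < poissonWeight n t := by
  unfold poissonWeight; positivity

lemma poissonWeight_nonneg (n : ℕ) {t : ℝ} (ht : 0 ≤ t) : 0 ≤ poissonWeight n t := by
  unfold poissonWeight; positivity

lemma poissonWeight_succ (n : ℕ) (t : ℝ) :
    (n + 1) * poissonWeight (n + 1) t = t * poissonWeight n t := by
  unfold poissonWeight
  rw [Nat.factorial_succ]
  push_cast
  have : (n.factorial : ℝ) ≠ 0 := by positivity
  field_simp
  ring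

lemma tail_nonneg (n : ℕ) {t : ℝ} (ht : 0 ≤ t) : 0 ≤ tail n t :=
  Finset.sum_nonneg fun _ _ => poissonWeight_nonneg _ ht

lemma tail_pos {n : ℕ} (hn : n ≠ 0) {t : ℝ} (ht : 0 < t) : 0 < tail n t :=
  Finset.sum_pos (fun _ _ => poissonWeight_pos _ ht) (by simpa using hn)

lemma hasDerivAt_poissonWeight_zero (t : ℝ) :
    HasDerivAt (poissonWeight 0) (-poissonWeight 0 t) t := by
  have : poissonWeight 0 = fun t => Real.exp (-t) := by funext t; simp [poissonWeight]
  rw [this]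
  simpa using (hasDerivAt_neg t).exp

lemma hasDerivAt_poissonWeight_succ (n : ℕ) (t : ℝ) :
    HasDerivAt (poissonWeight (n + 1)) (poissonWeight n t - poissonWeight (n + 1) t) t := by
  have h := ((hasDerivAt_pow (n + 1) t).div_const ((n + 1).factorial : ℝ)).mul
    (hasDerivAt_neg t).exp
  refine h.congr_deriv ?_
  unfold poissonWeight
  rw [Nat.factorial_succ]
  push_cast
  have : (n.factorial : ℝ) ≠ 0 := by positivity
  field_simp
  ring

lemma hasDerivAt_tail_succ (n : ℕ) (t : ℝ) :
    HasDerivAt (tail (n + 1)) (-poissonWeight n t) t := by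
  induction n with
  | zero =>
    have : tail (0 + 1) = poissonWeight 0 := by funext t; simp [tail]
    rw [this]
    exact hasDerivAt_poissonWeight_zero t
  | succ n ih =>
    have : tail (n + 1 + 1) = tail (n + 1) + poissonWeight (n + 1) := by
      funext t; simp [tail_succ]
    rw [this]
    exact (ih.add (hasDerivAt_poissonWeight_succ n t)).congr_deriv (by ring)

/-- Removing one ball from an empty bin does nothing: with truncated subtraction the formula
for the derivative also holds for `n = 0`. -/
lemma hasDerivAt_cdf (n : ℕ) (t : ℝ) : HasDerivAt (cdf n) (cdf (n - 1) t - cdf n t) t := by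
  cases n with
  | zero =>
    have : cdf 0 = fun _ => 1 := by funext t; exact cdf_zero t
    rw [this]
    simpa using hasDerivAt_const t (1 : ℝ)
  | succ n =>
    refine ((hasDerivAt_tail_succ n t).const_sub 1).congr_deriv ?_
    simp [cdf_succ]

lemma hasDerivAt_tail (n : ℕ) (t : ℝ) : HasDerivAt (tail n) (tail (n - 1) t - tail n t) t := by
  have h := (hasDerivAt_cdf n t).const_sub 1
  have e : (fun t => 1 - cdf n t) = tail n := by funext t; simp [cdf]
  rw [e] at h
  exact h.congr_deriv (by simp [cdf])

lemma continuous_cdf (n : ℕ) : Continuous (cdf n) :=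
  continuous_iff_continuousAt.2 fun t => (hasDerivAt_cdf n t).continuousAt

lemma continuous_tail (n : ℕ) : Continuous (tail n) :=
  continuous_iff_continuousAt.2 fun t => (hasDerivAt_tail n t).continuousAt

lemma continuous_poissonWeight (n : ℕ) : Continuous (poissonWeight n) := by
  unfold poissonWeight; fun_prop

lemma tail_at_zero {n : ℕ} (hn : n ≠ 0) : tail n 0 = 1 := by
  obtain ⟨n, rfl⟩ := Nat.exists_eq_succ_of_ne_zero hn
  simp [tail, Finset.sum_range_succ', poissonWeight]

lemma cdf_at_zero {n : ℕ} (hn : n ≠ 0) : cdf n 0 = 0 := by simp [cdf, tail_at_zero hn]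

lemma cdf_nonneg (n : ℕ) {t : ℝ} (ht : 0 ≤ t) : 0 ≤ cdf n t := by
  rcases Nat.eq_zero_or_pos n with rfl | hn
  · simp [cdf_zero]
  obtain ⟨n, rfl⟩ := Nat.exists_eq_succ_of_ne_zero hn.ne'
  have hm : MonotoneOn (cdf (n + 1)) (Ici 0) := by
    refine monotoneOn_of_deriv_nonneg (convex_Ici 0) (continuous_cdf _).continuousOn
      (fun x _ => (hasDerivAt_cdf _ x).differentiableAt.differentiableWithinAt) fun x hx => ?_
    rw [interior_Ici] at hx
    rw [(hasDerivAt_cdf _ x).deriv, Nat.add_sub_cancel, cdf_succ]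
    linarith [poissonWeight_pos n (mem_Ioi.1 hx)]
  have := hm (mem_Ici.2 le_rfl) (mem_Ici.2 ht) ht
  rwa [cdf_at_zero (Nat.succ_ne_zero n)] at this

lemma cdf_le_one (n : ℕ) {t : ℝ} (ht : 0 ≤ t) : cdf n t ≤ 1 := by
  have := tail_nonneg n ht
  simp only [cdf]; linarith

lemma cdf_pos (n : ℕ) {t : ℝ} (ht : 0 < t) : 0 < cdf n t := by
  have h := cdf_nonneg (n + 1) ht.le
  rw [cdf_succ] at h
  linarith [poissonWeight_pos n ht]

lemma tendsto_poissonWeight (n : ℕ) : Tendsto (poissonWeight n) atTop (𝓝 0) := by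
  have h := (Real.tendsto_pow_mul_exp_neg_atTop_nhds_zero n).div_const (n.factorial : ℝ)
  rw [zero_div] at h
  refine h.congr fun t => ?_
  unfold poissonWeight; ring

lemma tendsto_tail (n : ℕ) : Tendsto (tail n) atTop (𝓝 0) := by
  have := tendsto_finsetSum (Finset.range n) fun j _ => tendsto_poissonWeight j
  simpa only [tail, Finset.sum_const_zero] using! this

lemma tendsto_cdf (n : ℕ) : Tendsto (cdf n) atTop (𝓝 1) := by
  have := (tendsto_tail n).const_sub 1
  simpa only [cdf, sub_zero] using! this

lemma integrableOn_poissonWeight (n : ℕ) : IntegrableOn (poissonWeight n) (Ioi 0) := by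
  have h := (Real.GammaIntegral_convergent (s := n + 1) (by positivity)).div_const
    (n.factorial : ℝ)
  refine (integrableOn_congr_fun (fun t ht => ?_) measurableSet_Ioi).1 h
  simp only [add_sub_cancel_right, Real.rpow_natCast, poissonWeight]
  ring

lemma integral_poissonWeight (n : ℕ) : ∫ t in Ioi 0, poissonWeight n t = 1 := by
  have h := Real.Gamma_eq_integral (s := n + 1) (by positivity)
  rw [Real.Gamma_nat_eq_factorial] at h
  have e : ∫ t in Ioi 0, poissonWeight n t
      = ∫ t in Ioi 0, (Real.exp (-t) * t ^ ((n : ℝ) + 1 - 1)) / n.factorial := by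
    refine setIntegral_congr_fun measurableSet_Ioi fun t _ => ?_
    simp only [add_sub_cancel_right, Real.rpow_natCast, poissonWeight]
    ring
  rw [e, integral_div, ← h, div_self (by positivity)]

lemma integrableOn_tail (n : ℕ) : IntegrableOn (tail n) (Ioi 0) :=
  integrable_finsetSum _ fun j _ => integrableOn_poissonWeight j

lemma integral_tail (n : ℕ) : ∫ t in Ioi 0, tail n t = n := by
  unfold tail
  rw [integral_finsetSum _ fun j _ => integrableOn_poissonWeight j]
  simp [integral_poissonWeight]

/-! ### Monotonicity of the ratios of distribution functions and densities -/

/-- The ratio `cdf n / poissonWeight n` is decreasing in `n`; one step of it. -/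
lemma poissonWeight_mul_cdf_succ_le (n : ℕ) {t : ℝ} (ht : 0 ≤ t) :
    poissonWeight n t * cdf (n + 1) t ≤ cdf n t * poissonWeight (n + 1) t := by
  -- After division by `poissonWeight n t / (n + 1)`, the difference of the two sides is
  -- `t * cdf n t - (n + 1) * cdf (n + 1) t`, which vanishes at `0` and has derivative
  -- `cdf (n + 1) t`.
  have hd : ∀ x : ℝ, HasDerivAt (fun t => t * cdf n t - (n + 1) * cdf (n + 1) t)
      (cdf (n + 1) x) x := by
    intro x
    refine (((hasDerivAt_id x).mul (hasDerivAt_cdf n x)).sub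
      ((hasDerivAt_cdf (n + 1) x).const_mul ((n : ℝ) + 1))).congr_deriv ?_
    cases n with
    | zero => simp [cdf_succ, cdf_zero]
    | succ m =>
      have := poissonWeight_succ m x
      simp only [id, Nat.add_sub_cancel, cdf_succ]
      push_cast
      linear_combination -this
  have hm : MonotoneOn (fun t => t * cdf n t - (n + 1) * cdf (n + 1) t) (Ici 0) := by
    refine monotoneOn_of_deriv_nonneg (convex_Ici 0)
      (fun x _ => (hd x).continuousAt.continuousWithinAt)
      (fun x _ => (hd x).differentiableAt.differentiableWithinAt) fun x hx => ?_
    rw [interior_Ici] at hx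
    rw [(hd x).deriv]
    exact cdf_nonneg _ (le_of_lt hx)
  have h := hm (mem_Ici.2 le_rfl) (mem_Ici.2 ht) ht
  simp only [zero_mul, cdf_at_zero (Nat.succ_ne_zero n), mul_zero, sub_zero] at h
  have h1 : 0 ≤ poissonWeight n t * (t * cdf n t - (n + 1) * cdf (n + 1) t) :=
    mul_nonneg (poissonWeight_nonneg n ht) h
  have h2 : poissonWeight n t * (t * cdf n t - (n + 1) * cdf (n + 1) t) =
      (n + 1) * (cdf n t * poissonWeight (n + 1) t - poissonWeight n t * cdf (n + 1) t) := by
    linear_combination (-cdf n t) * poissonWeight_succ n t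
  rw [h2] at h1
  have := nonneg_of_mul_nonneg_right h1 (by positivity : (0 : ℝ) < n + 1)
  linarith

lemma antitone_cdf_div {t : ℝ} (ht : 0 < t) : Antitone fun n => cdf n t / poissonWeight n t := by
  refine antitone_nat_of_succ_le fun n => ?_
  rw [div_le_div_iff₀ (poissonWeight_pos _ ht) (poissonWeight_pos _ ht)]
  linarith [poissonWeight_mul_cdf_succ_le n ht.le]

lemma monotone_tail_div {t : ℝ} (ht : 0 < t) :
    Monotone fun n => tail n t / poissonWeight n t := by
  -- The ratio `s n` satisfies `s (n + 1) = (n + 1) / t * (s n + 1)`.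
  have hs : ∀ n : ℕ, tail (n + 1) t / poissonWeight (n + 1) t
      = (n + 1) / t * (tail n t / poissonWeight n t + 1) := by
    intro n
    have h := poissonWeight_succ n t
    have h1 := (poissonWeight_pos n ht).ne'
    have h2 := (poissonWeight_pos (n + 1) ht).ne'
    rw [tail_succ]
    field_simp
    linear_combination (-(tail n t + poissonWeight n t)) * h
  refine monotone_nat_of_le_succ fun n => ?_
  induction n with
  | zero => simpa [tail_zero] using
      div_nonneg (tail_nonneg 1 ht.le) (poissonWeight_nonneg 1 ht.le)
  | succ n ih =>
    rw [hs n, hs (n + 1)]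
    have := tail_nonneg n ht.le
    have := poissonWeight_pos n ht
    push_cast
    gcongr
    linarith

lemma poissonWeight_mul_cdf_le {m n : ℕ} (h : m ≤ n) {t : ℝ} (ht : 0 < t) :
    poissonWeight m t * cdf n t ≤ poissonWeight n t * cdf m t := by
  have := antitone_cdf_div ht h
  rw [div_le_div_iff₀ (poissonWeight_pos _ ht) (poissonWeight_pos _ ht)] at this
  linarith

lemma tail_mul_poissonWeight_le {m n : ℕ} (h : m ≤ n) {t : ℝ} (ht : 0 < t) :
    tail m t * poissonWeight n t ≤ tail n t * poissonWeight m t := by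
  have := monotone_tail_div ht h
  rwa [div_le_div_iff₀ (poissonWeight_pos _ ht) (poissonWeight_pos _ ht)] at this

lemma tail_succ_mul_poissonWeight_le {m n : ℕ} (h : m ≤ n) {t : ℝ} (ht : 0 < t) :
    tail (m + 1) t * poissonWeight n t ≤ tail (n + 1) t * poissonWeight m t := by
  rw [tail_succ, tail_succ]
  linarith [tail_mul_poissonWeight_le h ht]

/-! ### Number of surviving bins -/

variable {ι : Type*}

/-- The probability that all bins in `s` are empty at time `t`. -/
noncomputable def allEmpty (s : Finset ι) (v : ι → ℕ) (t : ℝ) : ℝ := ∏ l ∈ s, cdf (v l) t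

lemma allEmpty_congr {s : Finset ι} {v w : ι → ℕ} (h : ∀ l ∈ s, v l = w l) (t : ℝ) :
    allEmpty s v t = allEmpty s w t :=
  Finset.prod_congr rfl fun l hl => by rw [h l hl]

lemma allEmpty_pos (s : Finset ι) (v : ι → ℕ) {t : ℝ} (ht : 0 < t) : 0 < allEmpty s v t :=
  Finset.prod_pos fun _ _ => cdf_pos _ ht

lemma allEmpty_le_one (s : Finset ι) (v : ι → ℕ) {t : ℝ} (ht : 0 ≤ t) : allEmpty s v t ≤ 1 :=
  Finset.prod_le_one (fun _ _ => cdf_nonneg _ ht) fun _ _ => cdf_le_one _ ht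

variable [DecidableEq ι]

/-- The probability that exactly one bin in `s` is non-empty at time `t`. -/
noncomputable def oneLeft (s : Finset ι) (v : ι → ℕ) (t : ℝ) : ℝ :=
  ∑ l ∈ s, (∏ m ∈ s.erase l, cdf (v m) t) * tail (v l) t

lemma allEmpty_insert {i : ι} {s : Finset ι} (hi : i ∉ s) (v : ι → ℕ) (t : ℝ) :
    allEmpty (insert i s) v t = cdf (v i) t * allEmpty s v t :=
  Finset.prod_insert hi

lemma oneLeft_insert {i : ι} {s : Finset ι} (hi : i ∉ s) (v : ι → ℕ) (t : ℝ) :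
    oneLeft (insert i s) v t =
      cdf (v i) t * oneLeft s v t + tail (v i) t * allEmpty s v t := by
  unfold oneLeft allEmpty
  rw [Finset.sum_insert hi, Finset.erase_insert hi, Finset.mul_sum, add_comm, mul_comm (tail _ _)]
  congr 1
  refine Finset.sum_congr rfl fun l hl => ?_
  have hne : i ≠ l := fun h => hi (h ▸ hl)
  rw [Finset.erase_insert_of_ne hne,
    Finset.prod_insert (fun h => hi (Finset.mem_of_mem_erase h)), mul_assoc]

lemma oneLeft_congr {s : Finset ι} {v w : ι → ℕ} (h : ∀ l ∈ s, v l = w l) (t : ℝ) :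
    oneLeft s v t = oneLeft s w t := by
  refine Finset.sum_congr rfl fun l hl => ?_
  rw [h l hl]
  congr 1
  exact Finset.prod_congr rfl fun m hm => by rw [h m (Finset.mem_of_mem_erase hm)]

lemma hasDerivAt_allEmpty (s : Finset ι) (v : ι → ℕ) (t : ℝ) :
    HasDerivAt (allEmpty s v)
      (∑ l ∈ s, (∏ m ∈ s.erase l, cdf (v m) t) * (cdf (v l - 1) t - cdf (v l) t)) t := by
  have := HasDerivAt.fun_finsetProd (u := s) (f := fun l => cdf (v l)) (x := t)
    (fun l _ => hasDerivAt_cdf (v l) t)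
  simpa only [smul_eq_mul] using! this

lemma hasDerivAt_allEmpty' (s : Finset ι) (v : ι → ℕ) (t : ℝ) :
    HasDerivAt (allEmpty s v)
      (∑ l ∈ s, (allEmpty s (Function.update v l (v l - 1)) t - allEmpty s v t)) t := by
  refine (hasDerivAt_allEmpty s v t).congr_deriv (Finset.sum_congr rfl fun l hl => ?_)
  have h : ∀ w : ι → ℕ, allEmpty s w t = cdf (w l) t * ∏ m ∈ s.erase l, cdf (w m) t :=
    fun w => (Finset.mul_prod_erase s (fun m => cdf (w m) t) hl).symm
  have e : ∏ m ∈ s.erase l, cdf (Function.update v l (v l - 1) m) t =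
      ∏ m ∈ s.erase l, cdf (v m) t :=
    Finset.prod_congr rfl fun m hm => by rw [Function.update_of_ne (Finset.ne_of_mem_erase hm)]
  rw [h, h, Function.update_self, e]
  ring

/-- The Kolmogorov equation for the probability that one bin is left: every bin loses a ball
at rate one. -/
lemma hasDerivAt_oneLeft (s : Finset ι) (v : ι → ℕ) (t : ℝ) :
    HasDerivAt (oneLeft s v)
      (∑ l ∈ s, (oneLeft s (Function.update v l (v l - 1)) t - oneLeft s v t)) t := by
  induction s using Finset.induction_on with
  | empty =>
    have : oneLeft (∅ : Finset ι) v = fun _ => 0 := by funext t; simp [oneLeft]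
    rw [this]
    simpa using hasDerivAt_const t (0 : ℝ)
  | insert i s hi ih =>
    have e : oneLeft (insert i s) v =
        fun t => cdf (v i) t * oneLeft s v t + tail (v i) t * allEmpty s v t :=
      funext fun t => oneLeft_insert hi v t
    rw [e]
    refine (((hasDerivAt_cdf (v i) t).mul ih).add
      ((hasDerivAt_tail (v i) t).mul (hasDerivAt_allEmpty' s v t))).congr_deriv ?_
    rw [Finset.sum_insert hi]
    simp only [oneLeft_insert hi, Function.update_self]
    have h1 : ∀ l ∈ s, Function.update v i (v i - 1) l = v l := fun l hl =>
      Function.update_of_ne (ne_of_mem_of_not_mem hl hi) _ _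
    rw [oneLeft_congr h1, allEmpty_congr h1]
    have h2 : ∀ l ∈ s, Function.update v l (v l - 1) i = v i := fun l hl =>
      Function.update_of_ne (ne_of_mem_of_not_mem hl hi).symm _ _
    have h3 : ∑ l ∈ s, (cdf (Function.update v l (v l - 1) i) t *
          oneLeft s (Function.update v l (v l - 1)) t +
          tail (Function.update v l (v l - 1) i) t *
          allEmpty s (Function.update v l (v l - 1)) t -
          (cdf (v i) t * oneLeft s v t + tail (v i) t * allEmpty s v t)) =
        cdf (v i) t * ∑ l ∈ s, (oneLeft s (Function.update v l (v l - 1)) t - oneLeft s v t) +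
        tail (v i) t *
          ∑ l ∈ s, (allEmpty s (Function.update v l (v l - 1)) t - allEmpty s v t) := by
      rw [Finset.mul_sum, Finset.mul_sum, ← Finset.sum_add_distrib]
      exact Finset.sum_congr rfl fun l hl => by rw [h2 l hl]; ring
    rw [h3]
    ring

lemma continuous_allEmpty (s : Finset ι) (v : ι → ℕ) : Continuous (allEmpty s v) :=
  continuous_iff_continuousAt.2 fun t => (hasDerivAt_allEmpty s v t).continuousAt

lemma continuous_oneLeft (s : Finset ι) (v : ι → ℕ) : Continuous (oneLeft s v) :=
  continuous_iff_continuousAt.2 fun t => (hasDerivAt_oneLeft s v t).continuousAt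

lemma oneLeft_nonneg (s : Finset ι) (v : ι → ℕ) {t : ℝ} (ht : 0 ≤ t) : 0 ≤ oneLeft s v t :=
  Finset.sum_nonneg fun _ _ =>
    mul_nonneg (Finset.prod_nonneg fun _ _ => cdf_nonneg _ ht) (tail_nonneg _ ht)

lemma oneLeft_le (s : Finset ι) (v : ι → ℕ) {t : ℝ} (ht : 0 ≤ t) :
    oneLeft s v t ≤ ∑ l ∈ s, tail (v l) t :=
  Finset.sum_le_sum fun l _ => mul_le_of_le_one_left (tail_nonneg _ ht)
    (allEmpty_le_one (s.erase l) v ht)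

lemma integrableOn_oneLeft (s : Finset ι) (v : ι → ℕ) : IntegrableOn (oneLeft s v) (Ioi 0) := by
  have h : IntegrableOn (fun t => ∑ l ∈ s, tail (v l) t) (Ioi 0) :=
    integrable_finsetSum s fun l _ => integrableOn_tail (v l)
  refine Integrable.mono' h (continuous_oneLeft s v).aestronglyMeasurable ?_
  refine (ae_restrict_iff' measurableSet_Ioi).2 (Eventually.of_forall fun t ht => ?_)
  rw [Real.norm_of_nonneg (oneLeft_nonneg s v (le_of_lt ht))]
  exact oneLeft_le s v (le_of_lt ht)

lemma tendsto_oneLeft (s : Finset ι) (v : ι → ℕ) : Tendsto (oneLeft s v) atTop (𝓝 0) := by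
  have h : Tendsto (fun t => ∑ l ∈ s, tail (v l) t) atTop (𝓝 0) := by
    simpa using tendsto_finsetSum s fun l _ => tendsto_tail (v l)
  refine tendsto_of_tendsto_of_tendsto_of_le_of_le' tendsto_const_nhds h ?_ ?_
  · filter_upwards [eventually_ge_atTop 0] with t ht using oneLeft_nonneg s v ht
  · filter_upwards [eventually_ge_atTop 0] with t ht using oneLeft_le s v ht

/-! ### Moving a ball from a fullest bin -/

/-- The amount by which the integrand for the expected number of remaining balls drops when a
ball is moved from a bin with `n + 1` balls to a bin with `a` balls, and the other bins,
those in `s`, are filled according to `v`. -/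
noncomputable def exchangeGain (s : Finset ι) (v : ι → ℕ) (a n : ℕ) (t : ℝ) : ℝ :=
  allEmpty s v t * (poissonWeight a t - poissonWeight n t) +
    (2 * allEmpty s v t - oneLeft s v t) *
      (poissonWeight n t * cdf a t - poissonWeight a t * cdf n t)

/-- The function whose multiple `allEmpty s v * correction a n` has a derivative that turns
`exchangeGain s v a n` into a positive function. It is
`tail (n + 1) / poissonWeight n` times
`poissonWeight n * cdf a - poissonWeight a * cdf n`, where the
quotient `poissonWeight a / poissonWeight n` is written out as a power of `t`. -/
noncomputable def correction (a n : ℕ) (t : ℝ) : ℝ :=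
  tail (n + 1) t * (cdf a t - cdf n t * (n.factorial / a.factorial / t ^ (n - a)))

lemma ratio_mul_poissonWeight {a n : ℕ} (h : a ≤ n) {t : ℝ} (ht : 0 < t) :
    (n.factorial / a.factorial / t ^ (n - a) : ℝ) * poissonWeight n t = poissonWeight a t := by
  obtain ⟨d, rfl⟩ := Nat.exists_eq_add_of_le h
  unfold poissonWeight
  rw [Nat.add_sub_cancel_left, pow_add]
  field_simp

lemma correction_mul_poissonWeight {a n : ℕ} (h : a ≤ n) {t : ℝ} (ht : 0 < t) :
    correction a n t * poissonWeight n t = tail (n + 1) t *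
      (poissonWeight n t * cdf a t - poissonWeight a t * cdf n t) := by
  rw [← ratio_mul_poissonWeight h ht, correction]
  ring

lemma correction_nonneg {a n : ℕ} (h : a ≤ n) {t : ℝ} (ht : 0 < t) : 0 ≤ correction a n t := by
  refine nonneg_of_mul_nonneg_left ?_ (poissonWeight_pos n ht)
  rw [correction_mul_poissonWeight h ht]
  exact mul_nonneg (tail_nonneg _ ht.le) (by linarith [poissonWeight_mul_cdf_le h ht])

lemma correction_le {a n : ℕ} (h : a ≤ n) {t : ℝ} (ht : 0 < t) :
    correction a n t ≤ tail (n + 1) t * cdf (a + 1) t := by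
  refine mul_le_mul_of_nonneg_left ?_ (tail_nonneg _ ht.le)
  have h1 := cdf_nonneg (n + 1) ht.le
  rw [cdf_succ] at h1
  have h2 : (0 : ℝ) ≤ n.factorial / a.factorial / t ^ (n - a) := by positivity
  have h3 := mul_nonneg h1 h2
  rw [cdf_succ, ← ratio_mul_poissonWeight h ht]
  linarith

lemma hasDerivAt_correction {a n : ℕ} (h : a ≤ n) {t : ℝ} (ht : 0 < t) :
    HasDerivAt (correction a n)
      (-poissonWeight n t * cdf a t + poissonWeight a t * cdf n t +
        tail (n + 1) t * cdf (n + 1) t * ((n - a) / t) *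
          (n.factorial / a.factorial / t ^ (n - a))) t := by
  obtain ⟨d, rfl⟩ := Nat.exists_eq_add_of_le h
  have hd : HasDerivAt (fun t : ℝ => ((a + d).factorial / a.factorial / t ^ d : ℝ))
      (-(d / t) * ((a + d).factorial / a.factorial / t ^ d)) t := by
    have h1 := (hasDerivAt_const t ((a + d).factorial / a.factorial : ℝ)).div
      (hasDerivAt_pow d t) (by positivity)
    refine h1.congr_deriv ?_
    rcases d with _ | d
    · simp
    · rw [Nat.add_sub_cancel]
      field_simp
      ring
  have h2 := (hasDerivAt_tail_succ (a + d) t).mul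
    ((hasDerivAt_cdf a t).sub ((hasDerivAt_cdf (a + d) t).mul hd))
  have e : correction a (a + d) = tail (a + d + 1) * (cdf a - cdf (a + d) *
      fun t : ℝ => ((a + d).factorial / a.factorial / t ^ d : ℝ)) := by
    funext x
    simp [correction]
  rw [e]
  refine h2.congr_deriv ?_
  simp only [Pi.mul_apply, Pi.sub_apply, Nat.add_sub_cancel_left]
  have hr := ratio_mul_poissonWeight h ht
  rw [Nat.add_sub_cancel_left] at hr
  set κ : ℝ := (a + d).factorial / a.factorial / t ^ d with hκ
  -- The derivatives of the two distribution functions combine to `-(d / t) * poissonWeight a t`.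
  have key : (cdf (a - 1) t - cdf a t) - (cdf (a + d - 1) t - cdf (a + d) t) * κ =
      -(d / t) * poissonWeight a t := by
    rcases a with _ | a
    · rcases d with _ | d
      · simp
      · have hp := poissonWeight_succ (0 + d) t
        rw [show 0 + (d + 1) - 1 = 0 + d by omega, ← add_assoc, cdf_succ (0 + d)]
        rw [← add_assoc] at hr
        push_cast at hp ⊢
        field_simp
        simp only [sub_self, mul_zero, zero_sub]
        linear_combination (-((0 : ℝ) + d + 1)) * hr + κ * hp
    · have hp := poissonWeight_succ (a + d) t
      have hq := poissonWeight_succ a t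
      rw [show a + 1 + d = a + d + 1 by omega] at hr ⊢
      rw [Nat.add_sub_cancel, Nat.add_sub_cancel, cdf_succ (a + d), cdf_succ a]
      push_cast at hp ⊢
      field_simp
      linear_combination κ * hp - hq - (a + d + 1) * hr
  rw [cdf_succ]
  push_cast
  linear_combination tail (a + d + 1) t * key + (cdf (a + d) t + tail (a + d + 1) t * (d / t)) * hr

/-- The pointwise inequality behind the exchange: bins of `s` that contain at most `n + 1` balls
have a ratio `tail c / poissonWeight (c - 1)` of at most that for `n + 1` balls. -/
lemma exchangeGain_add_deriv_pos {a n : ℕ} (h : a < n) {s : Finset ι} {v : ι → ℕ}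
    (hv : ∀ l ∈ s, v l ≤ n + 1) {t : ℝ} (ht : 0 < t) :
    0 < exchangeGain s v a n t + deriv (fun t => allEmpty s v t * correction a n t) t := by
  have hA := allEmpty_pos s v ht
  have hd := (hasDerivAt_allEmpty s v t).mul (hasDerivAt_correction h.le ht)
  have hw : 0 ≤ poissonWeight n t * cdf a t - poissonWeight a t * cdf n t := by
    linarith [poissonWeight_mul_cdf_le h.le ht]
  rw [show (fun t => allEmpty s v t * correction a n t) = allEmpty s v * correction a n from rfl,
    hd.deriv]
  -- The bins of `s` are compared one at a time.
  have hB : oneLeft s v t * (poissonWeight n t * cdf a t - poissonWeight a t * cdf n t) ≤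
      (∑ l ∈ s, (∏ m ∈ s.erase l, cdf (v m) t) * (cdf (v l - 1) t - cdf (v l) t)) *
        correction a n t := by
    unfold oneLeft
    rw [Finset.sum_mul, Finset.sum_mul]
    refine Finset.sum_le_sum fun l hl => ?_
    rw [mul_assoc, mul_assoc]
    refine mul_le_mul_of_nonneg_left ?_ (Finset.prod_nonneg fun _ _ => cdf_nonneg _ ht.le)
    have hl' := hv l hl
    rcases hc : v l with _ | m
    · simp [tail_zero]
    · rw [Nat.add_sub_cancel, cdf_succ, sub_sub_cancel]
      refine le_of_mul_le_mul_right ?_ (poissonWeight_pos n ht)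
      rw [mul_assoc (poissonWeight m t), correction_mul_poissonWeight h.le ht]
      have := mul_le_mul_of_nonneg_right
        (tail_succ_mul_poissonWeight_le (m := m) (n := n) (by omega) ht) hw
      linarith
  have hq : 0 ≤ poissonWeight a t * tail n t - poissonWeight n t * tail a t := by
    linarith [tail_mul_poissonWeight_le h.le ht]
  have hpos : 0 < tail (n + 1) t * cdf (n + 1) t * ((n - a) / t) *
      (n.factorial / a.factorial / t ^ (n - a) : ℝ) := by
    have h1 := tail_pos (Nat.succ_ne_zero n) ht
    have h2 := cdf_pos (n + 1) ht
    have h3 : (0 : ℝ) < n - a := sub_pos.2 (by exact_mod_cast h)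
    positivity
  have hsum := mul_pos hA (add_pos_of_nonneg_of_pos hq hpos)
  unfold exchangeGain
  have e1 : tail n t = 1 - cdf n t := by simp [cdf]
  have e2 : tail a t = 1 - cdf a t := by simp [cdf]
  rw [e1, e2] at hsum
  linarith

/-- A continuous integrable function has positive integral over `(0, ∞)` if adding to it the
derivative of a function with vanishing limits at both ends makes it positive. -/
lemma integral_pos_of_add_deriv_pos {g u : ℝ → ℝ} (hg : Continuous g)
    (hgi : IntegrableOn g (Ioi 0)) (hu : ∀ t, 0 < t → DifferentiableAt ℝ u t)
    (h0 : Tendsto u (𝓝[>] 0) (𝓝 0)) (hinf : Tendsto u atTop (𝓝 0))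
    (hpos : ∀ t, 0 < t → 0 < g t + deriv u t) : 0 < ∫ t in Ioi 0, g t := by
  have hJ : ∀ t, 0 < t → HasDerivAt (fun t => (∫ x in (0 : ℝ)..t, g x) + u t)
      (g t + deriv u t) t := fun t ht =>
    (intervalIntegral.integral_hasDerivAt_right (hg.intervalIntegrable _ _)
      (hg.stronglyMeasurableAtFilter _ _) hg.continuousAt).add (hu t ht).hasDerivAt
  have hmono : StrictMonoOn (fun t => (∫ x in (0 : ℝ)..t, g x) + u t) (Ioi 0) := by
    refine strictMonoOn_of_deriv_pos (convex_Ioi 0)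
      (fun t ht => (hJ t ht).continuousAt.continuousWithinAt) fun t ht => ?_
    rw [interior_Ioi] at ht
    rw [(hJ t ht).deriv]
    exact hpos t ht
  have hlim0 : Tendsto (fun t => (∫ x in (0 : ℝ)..t, g x) + u t) (𝓝[>] 0) (𝓝 0) := by
    have hc : Continuous fun t => ∫ x in (0 : ℝ)..t, g x :=
      intervalIntegral.continuous_primitive (fun a b => hg.intervalIntegrable a b) 0
    have := (hc.tendsto 0).mono_left (nhdsWithin_le_nhds (s := Ioi 0))
    simpa using this.add h0
  have hlim : Tendsto (fun t => (∫ x in (0 : ℝ)..t, g x) + u t) atTop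
      (𝓝 (∫ t in Ioi 0, g t)) := by
    simpa using (intervalIntegral_tendsto_integral_Ioi 0 hgi tendsto_id).add hinf
  have h1 : 0 ≤ (∫ x in (0 : ℝ)..1, g x) + u 1 := by
    refine le_of_tendsto hlim0 ?_
    filter_upwards [Ioo_mem_nhdsGT (zero_lt_one' ℝ)] with t ht
    exact (hmono ht.1 (mem_Ioi.2 one_pos) ht.2).le
  have h2 : (∫ x in (0 : ℝ)..2, g x) + u 2 ≤ ∫ t in Ioi 0, g t := by
    refine ge_of_tendsto hlim ?_
    filter_upwards [eventually_gt_atTop 2] with t ht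
    exact (hmono (mem_Ioi.2 two_pos) (mem_Ioi.2 (two_pos.trans ht)) ht).le
  have h3 := hmono (mem_Ioi.2 one_pos) (mem_Ioi.2 two_pos) one_lt_two
  simp only at h3
  linarith

lemma continuous_exchangeGain (s : Finset ι) (v : ι → ℕ) (a n : ℕ) :
    Continuous (exchangeGain s v a n) := by
  have h1 := continuous_allEmpty s v
  have h2 := continuous_oneLeft s v
  have h3 := continuous_poissonWeight a
  have h4 := continuous_poissonWeight n
  have h5 := continuous_cdf a
  have h6 := continuous_cdf n
  unfold exchangeGain
  fun_prop

lemma integral_exchangeGain_pos {a n : ℕ} (h : a < n) {s : Finset ι} {v : ι → ℕ}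
    (hv : ∀ l ∈ s, v l ≤ n + 1) (hi : IntegrableOn (exchangeGain s v a n) (Ioi 0)) :
    0 < ∫ t in Ioi 0, exchangeGain s v a n t := by
  have hle : ∀ t, 0 < t → allEmpty s v t * correction a n t ≤ tail (n + 1) t * cdf (a + 1) t :=
    fun t ht => (mul_le_of_le_one_left (correction_nonneg h.le ht)
      (allEmpty_le_one s v ht.le)).trans (correction_le h.le ht)
  have hnn : ∀ t, 0 < t → 0 ≤ allEmpty s v t * correction a n t := fun t ht =>
    mul_nonneg (allEmpty_pos s v ht).le (correction_nonneg h.le ht)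
  refine integral_pos_of_add_deriv_pos (u := fun t => allEmpty s v t * correction a n t)
    (continuous_exchangeGain s v a n) hi (fun t ht => ?_) ?_ ?_
    fun t ht => exchangeGain_add_deriv_pos h hv ht
  · exact (hasDerivAt_allEmpty s v t).differentiableAt.mul
      (hasDerivAt_correction h.le ht).differentiableAt
  · have hc : Continuous fun t => tail (n + 1) t * cdf (a + 1) t :=
      (continuous_tail _).mul (continuous_cdf _)
    have hl := (hc.tendsto 0).mono_left (nhdsWithin_le_nhds (s := Ioi 0))
    simp only [cdf_at_zero (Nat.succ_ne_zero a), mul_zero] at hl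
    refine tendsto_of_tendsto_of_tendsto_of_le_of_le' tendsto_const_nhds hl ?_ ?_
    · filter_upwards [self_mem_nhdsWithin] with t ht using hnn t ht
    · filter_upwards [self_mem_nhdsWithin] with t ht using hle t ht
  · have hl := (tendsto_tail (n + 1)).mul (tendsto_cdf (a + 1))
    rw [zero_mul] at hl
    refine tendsto_of_tendsto_of_tendsto_of_le_of_le' tendsto_const_nhds hl ?_ ?_
    · filter_upwards [eventually_gt_atTop 0] with t ht using hnn t ht
    · filter_upwards [eventually_gt_atTop 0] with t ht using hle t ht

variable {k : ℕ}

/-! ### The expected duration of the last phase -/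

/-- The expected duration of the phase with exactly one non-empty bin, when every bin loses balls
at the events of its own rate one Poisson process. -/
noncomputable def lastPhase (v : Fin k → ℕ) : ℝ := ∫ t in Ioi 0, oneLeft Finset.univ v t

lemma lastPhase_nonneg (v : Fin k → ℕ) : 0 ≤ lastPhase v :=
  setIntegral_nonneg measurableSet_Ioi fun _ ht => oneLeft_nonneg _ _ (le_of_lt ht)

lemma mem_nonemptyBins {v : Fin k → ℕ} {i : Fin k} : i ∈ nonemptyBins v ↔ v i ≠ 0 := by
  simp [nonemptyBins]

/-- With at most one non-empty bin the last phase lasts until all balls are removed. -/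
lemma lastPhase_of_card_le_one {v : Fin k → ℕ} (h : (nonemptyBins v).card ≤ 1) :
    lastPhase v = total v := by
  by_cases hk : Nonempty (Fin k)
  · obtain ⟨i, hi⟩ := Finset.card_le_one_iff_subset_singleton.1 h
    have hz : ∀ l, l ≠ i → v l = 0 := fun l hl => by
      by_contra hv
      exact hl (Finset.mem_singleton.1 (hi (mem_nonemptyBins.2 hv)))
    have h1 : oneLeft Finset.univ v = tail (v i) := by
      funext t
      unfold oneLeft
      rw [Finset.sum_eq_single i]
      · rw [Finset.prod_eq_one, one_mul]
        intro m hm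
        rw [hz m (Finset.ne_of_mem_erase hm), cdf_zero]
      · intro l _ hl
        rw [hz l hl, tail_zero, mul_zero]
      · simp
    have h2 : total v = v i := by
      unfold total
      exact Finset.sum_eq_single i (fun l _ hl => hz l hl) (by simp)
    rw [lastPhase, h1, integral_tail, h2]
  · rw [not_nonempty_iff] at hk
    simp [lastPhase, oneLeft, total]

/-- First step analysis for the last phase: integrate the Kolmogorov equation over time. -/
lemma card_mul_lastPhase {v : Fin k → ℕ} (h : 2 ≤ (nonemptyBins v).card) :
    k * lastPhase v = ∑ i, lastPhase (removeBall v i) := by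
  have hint : ∀ l ∈ Finset.univ, IntegrableOn
      (fun t => oneLeft Finset.univ (removeBall v l) t - oneLeft Finset.univ v t) (Ioi 0) :=
    fun l _ => (integrableOn_oneLeft _ _).sub (integrableOn_oneLeft _ _)
  have hz : oneLeft Finset.univ v 0 = 0 := by
    refine Finset.sum_eq_zero fun l _ => mul_eq_zero_of_left ?_ _
    obtain ⟨m, hm, hml⟩ := Finset.exists_mem_ne h l
    exact Finset.prod_eq_zero (Finset.mem_erase.2 ⟨hml, Finset.mem_univ m⟩)
      (cdf_at_zero (mem_nonemptyBins.1 hm))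
  have hI := integral_Ioi_of_hasDerivAt_of_tendsto' (a := (0 : ℝ))
    (fun t _ => hasDerivAt_oneLeft Finset.univ v t)
    (integrable_finsetSum _ hint) (tendsto_oneLeft Finset.univ v)
  rw [hz, sub_zero] at hI
  have hI2 : ∑ l, (lastPhase (removeBall v l) - lastPhase v) = 0 := by
    rw [← hI]
    refine Eq.trans ?_ (integral_finsetSum _ hint).symm
    exact Finset.sum_congr rfl fun l _ =>
      (integral_sub (integrableOn_oneLeft _ _) (integrableOn_oneLeft _ _)).symm
  rw [Finset.sum_sub_distrib] at hI2
  simp only [Finset.sum_const, Finset.card_univ, Fintype.card_fin, nsmul_eq_mul] at hI2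
  linarith

/-- Moving a ball from a fullest bin to a bin with at least two balls fewer shortens the last
phase. -/
lemma lastPhase_exchange_lt {v : Fin k → ℕ} {i j : Fin k} (hmax : ∀ l, v l ≤ v i)
    (hij : v j + 2 ≤ v i) :
    lastPhase (Function.update (Function.update v i (v i - 1)) j (v j + 1)) < lastPhase v := by
  set w := Function.update (Function.update v i (v i - 1)) j (v j + 1) with hw
  have hne : i ≠ j := by rintro rfl; omega
  obtain ⟨n, hn⟩ : ∃ n, v i = n + 1 := ⟨v i - 1, by omega⟩
  have hwi : w i = n := by simp [hw, hne, hn]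
  have hwj : w j = v j + 1 := by simp [hw]
  set s : Finset (Fin k) := (Finset.univ.erase i).erase j with hs
  have hjs : j ∉ s := Finset.notMem_erase _ _
  have his : i ∉ insert j s := by simp [hs, hne]
  have huniv : (Finset.univ : Finset (Fin k)) = insert i (insert j s) := by
    rw [hs, Finset.insert_erase (Finset.mem_erase.2 ⟨hne.symm, Finset.mem_univ j⟩),
      Finset.insert_erase (Finset.mem_univ i)]
  have hsw : ∀ l ∈ s, w l = v l := fun l hl => by
    have h1 := Finset.ne_of_mem_erase hl
    have h2 := Finset.ne_of_mem_erase (Finset.mem_of_mem_erase hl)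
    simp [hw, h1, h2]
  have hdiff : ∀ t, exchangeGain s v (v j) n t =
      oneLeft Finset.univ v t - oneLeft Finset.univ w t := by
    intro t
    rw [huniv, oneLeft_insert his, oneLeft_insert his, oneLeft_insert hjs, oneLeft_insert hjs,
      allEmpty_insert hjs, allEmpty_insert hjs, oneLeft_congr hsw, allEmpty_congr hsw,
      hwi, hwj, hn, exchangeGain]
    simp only [tail_succ, cdf_succ]
    simp only [cdf]
    ring
  have hint : IntegrableOn (exchangeGain s v (v j) n) (Ioi 0) := by
    rw [funext hdiff]
    exact (integrableOn_oneLeft _ _).sub (integrableOn_oneLeft _ _)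
  have hpos := integral_exchangeGain_pos (a := v j) (n := n) (by omega)
    (fun l _ => hn ▸ hmax l) hint
  simp only [hdiff] at hpos
  rw [integral_sub (integrableOn_oneLeft _ _) (integrableOn_oneLeft _ _)] at hpos
  exact sub_pos.1 hpos

lemma lastPhase_comp_perm (v : Fin k → ℕ) (σ : Equiv.Perm (Fin k)) :
    lastPhase (v ∘ σ) = lastPhase v := by
  unfold lastPhase
  congr 1
  funext t
  unfold oneLeft
  rw [← Equiv.sum_comp σ fun l => (∏ m ∈ Finset.univ.erase l, cdf (v m) t) * tail (v l) t]
  refine Finset.sum_congr rfl fun l _ => ?_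
  congr 1
  have : Finset.univ.erase (σ l) = (Finset.univ.erase l).map σ.toEmbedding := by
    ext m
    simp
  rw [this, Finset.prod_map]
  rfl

/-! ### First step analysis determines a function -/

lemma total_removeBall {v : Fin k → ℕ} {i : Fin k} (h : v i ≠ 0) :
    total (removeBall v i) + 1 = total v := by
  unfold total removeBall
  rw [Finset.sum_update_of_mem (Finset.mem_univ i),
    ← Finset.add_sum_erase _ v (Finset.mem_univ i), Finset.sdiff_singleton_eq_erase]
  omega

lemma removeBall_of_eq_zero {v : Fin k → ℕ} {i : Fin k} (h : v i = 0) : removeBall v i = v := by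
  simp [removeBall, h]

lemma sum_removeBall (X : (Fin k → ℕ) → ℝ) (v : Fin k → ℕ) :
    ∑ i, X (removeBall v i) =
      ∑ i ∈ nonemptyBins v, X (removeBall v i) + (k - (nonemptyBins v).card) * X v := by
  rw [← Finset.sum_add_sum_compl (nonemptyBins v)]
  congr 1
  rw [Finset.sum_congr rfl (g := fun _ => X v) fun i hi => by
    rw [removeBall_of_eq_zero]
    simpa [mem_nonemptyBins] using hi]
  rw [Finset.sum_const, Finset.card_compl, nsmul_eq_mul, Fintype.card_fin,
    Nat.cast_sub (by simpa using Finset.card_le_univ (nonemptyBins v))]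

/-- The terms of empty bins only repeat the value at `v`, so the equation expresses that value by
values at assignments with fewer balls. -/
lemma eq_of_first_step {X Y : (Fin k → ℕ) → ℝ}
    (hX : ∀ v, 2 ≤ (nonemptyBins v).card → k * X v = ∑ i, X (removeBall v i))
    (hY : ∀ v, 2 ≤ (nonemptyBins v).card → k * Y v = ∑ i, Y (removeBall v i))
    (hXY : ∀ v, (nonemptyBins v).card ≤ 1 → X v = Y v) (v : Fin k → ℕ) : X v = Y v := by
  induction hn : total v using Nat.strong_induction_on generalizing v with
  | _ n ih =>
    by_cases h : (nonemptyBins v).card ≤ 1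
    · exact hXY v h
    · push Not at h
      have h1 := hX v h
      have h2 := hY v h
      rw [sum_removeBall] at h1 h2
      have h3 : ∑ i ∈ nonemptyBins v, X (removeBall v i) =
          ∑ i ∈ nonemptyBins v, Y (removeBall v i) := by
        refine Finset.sum_congr rfl fun i hi => ih _ ?_ _ rfl
        have := total_removeBall (mem_nonemptyBins.1 hi)
        omega
      have h4 : ((nonemptyBins v).card : ℝ) ≠ 0 := by
        have : (nonemptyBins v).card ≠ 0 := by omega
        exact_mod_cast this
      refine mul_left_cancel₀ h4 ?_
      linarith

lemma total_eq_zero_iff {v : Fin k → ℕ} : total v = 0 ↔ v = 0 := by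
  simp [total, funext_iff]

lemma nonemptyBins_eq_empty_iff {v : Fin k → ℕ} : nonemptyBins v = ∅ ↔ v = 0 := by
  simp [nonemptyBins, funext_iff, Finset.filter_eq_empty_iff]

lemma removeBall_ne_zero {v : Fin k → ℕ} (h : 2 ≤ (nonemptyBins v).card) (i : Fin k) :
    removeBall v i ≠ 0 := by
  obtain ⟨m, hm, hmi⟩ := Finset.exists_mem_ne h i
  intro h0
  have := congrFun h0 m
  rw [removeBall, Function.update_of_ne hmi] at this
  exact mem_nonemptyBins.1 hm this

/-! ### The process that chooses among the non-empty bins -/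

lemma law_of_card_le_one {v : Fin k → ℕ} (h : (nonemptyBins v).card ≤ 1) (t : ℕ) :
    law t v = PMF.pure v := by
  induction t with
  | zero => rfl
  | succ t ih => rw [law, step, dif_neg (by omega), PMF.pure_bind, ih]

/-- After `total v` rounds the process has ended, so the number of rounds does not matter from
then on. -/
lemma tsum_law_mul_total (t : ℕ) (v : Fin k → ℕ) (h : total v ≤ t) :
    ∑' w, law t v w * (total w : ENNReal) = ENNReal.ofReal (lastPhase v) := by
  induction t generalizing v with
  | zero =>
    have hv : v = 0 := total_eq_zero_iff.1 (Nat.le_zero.1 h)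
    have hc : (nonemptyBins v).card ≤ 1 := by
      rw [nonemptyBins_eq_empty_iff.2 hv]; simp
    rw [lastPhase_of_card_le_one hc, law, tsum_eq_single v]
    · simp
    · intro w hw
      rw [PMF.pure_apply, if_neg hw, zero_mul]
  | succ t ih =>
    by_cases hc : (nonemptyBins v).card ≤ 1
    · rw [lastPhase_of_card_le_one hc, law_of_card_le_one hc, tsum_eq_single v]
      · simp
      · intro w hw
        rw [PMF.pure_apply, if_neg hw, zero_mul]
    · replace hc : 2 ≤ (nonemptyBins v).card := by omega
      have hc' : (nonemptyBins v).Nonempty := Finset.card_pos.1 (by omega)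
      have hpos : (0 : ℝ) < (nonemptyBins v).card := by exact_mod_cast (by omega)
      have hrec := card_mul_lastPhase hc
      rw [sum_removeBall] at hrec
      have hlast : lastPhase v =
          ∑ i ∈ nonemptyBins v, ((nonemptyBins v).card : ℝ)⁻¹ * lastPhase (removeBall v i) := by
        rw [← Finset.mul_sum, eq_inv_mul_iff_mul_eq₀ hpos.ne']
        linarith
      rw [law, step, dif_pos hc, PMF.bind_map, hlast, ENNReal.ofReal_sum_of_nonneg
        (fun i _ => mul_nonneg (by positivity) (lastPhase_nonneg _))]
      simp only [PMF.bind_apply, Function.comp_apply]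
      have hswap : ∑' w, (∑' i, PMF.uniformOfFinset (nonemptyBins v) hc' i *
            law t (removeBall v i) w) * (total w : ENNReal) =
          ∑' i, PMF.uniformOfFinset (nonemptyBins v) hc' i *
            ∑' w, law t (removeBall v i) w * (total w : ENNReal) := by
        simp only [← ENNReal.tsum_mul_right, ← ENNReal.tsum_mul_left, mul_assoc]
        exact ENNReal.tsum_comm
      rw [hswap, tsum_eq_sum (s := nonemptyBins v)]
      · refine Finset.sum_congr rfl fun i hi => ?_
        have := total_removeBall (mem_nonemptyBins.1 hi)
        rw [ih _ (by omega), PMF.uniformOfFinset_apply_of_mem _ hi,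
          ENNReal.ofReal_mul (by positivity), ENNReal.ofReal_inv_of_pos hpos,
          ENNReal.ofReal_natCast]
      · intro i hi
        rw [PMF.uniformOfFinset_apply_of_notMem _ hi, zero_mul]

lemma fNonempty_eq_lastPhase (v : Fin k → ℕ) : fNonempty v = lastPhase v := by
  have h := tsum_law_mul_total (total v) v le_rfl
  rw [fNonempty, integral_eq_lintegral_of_nonneg_ae (Eventually.of_forall fun w => by positivity)
    (measurable_of_countable _).aestronglyMeasurable,
    lintegral_countable']
  simp only [ENNReal.ofReal_natCast, PMF.toMeasure_apply_singleton _ _ (measurableSet_singleton _)]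
  rw [← ENNReal.toReal_ofReal (lastPhase_nonneg v), ← h]
  simp only [mul_comm]

/-! ### The process that chooses among all bins -/

/-- The sequence of choices with first choice `i`, continued by `ω`. -/
def consChoice (i : Fin k) (ω : ℕ → Fin k) : ℕ → Fin k
  | 0 => i
  | n + 1 => ω n

lemma measurable_consChoice :
    Measurable fun p : Fin k × (ℕ → Fin k) => consChoice p.1 p.2 := by
  refine measurable_pi_iff.2 fun n => ?_
  cases n with
  | zero => exact measurable_fst
  | succ n => exact (measurable_pi_apply n).comp measurable_snd

instance [NeZero k] : IsProbabilityMeasure (choiceMeasure k) := by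
  unfold choiceMeasure; infer_instance

/-- The first choice is uniform, and independent of the later ones, which again have the law
`choiceMeasure`. -/
lemma map_consChoice [NeZero k] :
    (((PMF.uniformOfFintype (Fin k)).toMeasure.prod (choiceMeasure k)).map
      fun p => consChoice p.1 p.2) = choiceMeasure k := by
  refine Measure.eq_infinitePi _ fun s u hu => ?_
  set s' : Finset ℕ := s.preimage Nat.succ Nat.succ_injective.injOn
  have hs' : ∀ n, n ∈ s' ↔ n + 1 ∈ s := fun n => Finset.mem_preimage
  have hpre : (fun p : Fin k × (ℕ → Fin k) => consChoice p.1 p.2) ⁻¹' (Set.pi s u) =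
      (if 0 ∈ s then u 0 else univ) ×ˢ Set.pi s' (fun n => u (n + 1)) := by
    ext ⟨i, ω⟩
    simp only [mem_preimage, Set.mem_pi, mem_prod, Finset.mem_coe]
    constructor
    · intro h
      refine ⟨?_, fun n hn => h (n + 1) ((hs' n).1 hn)⟩
      split_ifs with h0
      · exact h 0 h0
      · trivial
    · rintro ⟨h1, h2⟩ (_ | n) hn
      · rwa [if_pos hn] at h1
      · exact h2 n ((hs' n).2 hn)
  rw [Measure.map_apply measurable_consChoice
    (MeasurableSet.pi s.countable_toSet fun n _ => hu n), hpre, Measure.prod_prod, choiceMeasure,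
    Measure.infinitePi_pi _ fun n _ => hu (n + 1)]
  have hs : ∏ n ∈ s', (PMF.uniformOfFintype (Fin k)).toMeasure (u (n + 1)) =
      ∏ n ∈ s.erase 0, (PMF.uniformOfFintype (Fin k)).toMeasure (u n) := by
    refine Finset.prod_bij (fun n _ => n + 1) (fun n hn => ?_) (fun _ _ _ _ h => by omega)
      (fun n hn => ?_) fun _ _ => rfl
    · exact Finset.mem_erase.2 ⟨by omega, (hs' n).1 hn⟩
    · obtain ⟨h0, hn⟩ := Finset.mem_erase.1 hn
      obtain ⟨m, rfl⟩ := Nat.exists_eq_succ_of_ne_zero h0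
      exact ⟨m, (hs' m).2 hn, rfl⟩
  rw [hs]
  split_ifs with h0
  · exact Finset.mul_prod_erase s (fun n => (PMF.uniformOfFintype (Fin k)).toMeasure (u n)) h0
  · rw [measure_univ, one_mul, Finset.erase_eq_of_notMem h0]

lemma integral_choiceMeasure [NeZero k] {g : (ℕ → Fin k) → ℝ} (hg : Measurable g) {C : ℝ}
    (hC : ∀ ω, ‖g ω‖ ≤ C) :
    k * ∫ ω, g ω ∂(choiceMeasure k) = ∑ i, ∫ ω, g (consChoice i ω) ∂(choiceMeasure k) := by
  have hm : Measurable fun p : Fin k × (ℕ → Fin k) => g (consChoice p.1 p.2) :=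
    hg.comp measurable_consChoice
  conv_lhs => rw [← map_consChoice]
  rw [integral_map measurable_consChoice.aemeasurable hg.aestronglyMeasurable,
    integral_prod _ (Integrable.of_bound hm.aestronglyMeasurable C
      (Eventually.of_forall fun p => hC _)), PMF.integral_eq_sum, Finset.mul_sum]
  refine Finset.sum_congr rfl fun i _ => ?_
  have hk : (k : ℝ) ≠ 0 := by exact_mod_cast NeZero.ne k
  simp [hk]

lemma state_consChoice (v : Fin k → ℕ) (i : Fin k) (ω : ℕ → Fin k) (t : ℕ) :
    state v (consChoice i ω) (t + 1) = state (removeBall v i) ω t := by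
  induction t with
  | zero => rfl
  | succ t ih => rw [state, ih]; rfl

lemma measurable_state (v : Fin k → ℕ) (t : ℕ) : Measurable fun ω => state v ω t := by
  induction t with
  | zero => exact measurable_const
  | succ t ih =>
    have h : Measurable fun p : (Fin k → ℕ) × Fin k => removeBall p.1 p.2 :=
      measurable_from_prod_countable_right fun _ => measurable_of_countable _
    exact h.comp (ih.prodMk (measurable_pi_apply t))

lemma measurableSet_card_eq_one (v : Fin k → ℕ) (t : ℕ) :
    MeasurableSet {ω : ℕ → Fin k | (nonemptyBins (state v ω t)).card = 1} :=
  (measurable_of_countable fun w : Fin k → ℕ => (nonemptyBins w).card).comp (measurable_state v t)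
    (measurableSet_singleton 1)

lemma measurable_stopTime (v : Fin k → ℕ) : Measurable (stopTime v) := by
  refine measurable_to_countable' fun n => ?_
  have h : stopTime v ⁻¹' {n} =
      ({ω | (nonemptyBins (state v ω n)).card = 1} ∩
        ⋂ m ∈ Finset.range n, {ω | (nonemptyBins (state v ω m)).card = 1}ᶜ) ∪
      {_ω | n = 0} ∩ ⋂ m, {ω | (nonemptyBins (state v ω m)).card = 1}ᶜ := by
    ext ω
    simp only [mem_preimage, mem_singleton_iff, mem_union, mem_inter_iff, mem_iInter,
      Finset.mem_range, mem_compl_iff, mem_ofPred_eq, stopTime]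
    constructor
    · rintro rfl
      rcases Set.eq_empty_or_nonempty {t | (nonemptyBins (state v ω t)).card = 1} with h | h
      · exact Or.inr ⟨by rw [h, Nat.sInf_empty], fun m hm => by
          have : m ∈ {t | (nonemptyBins (state v ω t)).card = 1} := hm
          rw [h] at this
          exact this⟩
      · exact Or.inl ⟨Nat.sInf_mem h, fun m hm h' =>
          Nat.notMem_of_lt_sInf (s := {t | (nonemptyBins (state v ω t)).card = 1}) hm h'⟩
    · rintro (⟨h1, h2⟩ | ⟨rfl, h⟩)
      · refine le_antisymm (Nat.sInf_le h1) (not_lt.1 fun hlt => h2 _ hlt ?_)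
        exact Nat.sInf_mem (s := {t | (nonemptyBins (state v ω t)).card = 1}) ⟨n, h1⟩
      · exact Nat.sInf_eq_zero.2 (Or.inr (Set.eq_empty_of_forall_notMem h))
  rw [h]
  exact ((measurableSet_card_eq_one v n).inter (Finset.measurableSet_biInter _ fun m _ =>
    (measurableSet_card_eq_one v m).compl)).union ((MeasurableSet.const _).inter
      (MeasurableSet.iInter fun m => (measurableSet_card_eq_one v m).compl))

lemma measurable_remaining (v : Fin k → ℕ) : Measurable (remaining v) := by
  have h1 : Measurable fun p : (ℕ → Fin k) × ℕ => state v p.1 p.2 :=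
    measurable_from_prod_countable_left fun t => measurable_state v t
  have h2 : Measurable (total : (Fin k → ℕ) → ℕ) := measurable_of_countable _
  exact h2.comp (h1.comp (measurable_id.prodMk (measurable_stopTime v)))

lemma total_state_le (v : Fin k → ℕ) (ω : ℕ → Fin k) (t : ℕ) : total (state v ω t) ≤ total v := by
  induction t with
  | zero => rfl
  | succ t ih =>
    refine le_trans ?_ ih
    rw [state]
    by_cases h : state v ω t (ω t) = 0
    · rw [removeBall_of_eq_zero h]
    · have := total_removeBall h
      omega

/-- The choices for which no round has a unique non-empty bin. -/
def neverOne (v : Fin k → ℕ) : Set (ℕ → Fin k) := {ω | ∀ t, (nonemptyBins (state v ω t)).card ≠ 1}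

lemma measurableSet_neverOne (v : Fin k → ℕ) : MeasurableSet (neverOne v) := by
  unfold neverOne
  rw [ofPred_forall]
  exact MeasurableSet.iInter fun t => (measurableSet_card_eq_one v t).compl

lemma consChoice_mem_neverOne {v : Fin k → ℕ} (h : (nonemptyBins v).card ≠ 1) (i : Fin k)
    (ω : ℕ → Fin k) : consChoice i ω ∈ neverOne v ↔ ω ∈ neverOne (removeBall v i) := by
  constructor
  · intro hω t
    rw [← state_consChoice]
    exact hω (t + 1)
  · rintro hω (_ | t)
    · exact h
    · rw [state_consChoice]
      exact hω t

/-- Almost surely some round has a unique non-empty bin, unless there are no balls. The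
probability of the contrary satisfies the first step equation. -/
lemma measure_neverOne [NeZero k] {v : Fin k → ℕ} (hv : v ≠ 0) :
    choiceMeasure k (neverOne v) = 0 := by
  classical
  have key := eq_of_first_step
    (X := fun v => ∫ ω, (neverOne v).indicator (fun _ => (1 : ℝ)) ω ∂(choiceMeasure k))
    (Y := fun v : Fin k → ℕ => if v = 0 then 1 else 0) (fun v h => ?_) (fun v h => ?_)
    (fun v h => ?_) v
  · simp only [if_neg hv] at key
    rw [integral_indicator_const _ (measurableSet_neverOne v), smul_eq_mul, mul_one,
      measureReal_eq_zero_iff] at key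
    exact key
  · rw [integral_choiceMeasure (C := 1)
      (measurable_const.indicator (measurableSet_neverOne v)) fun ω =>
        (norm_indicator_le_norm_self _ _).trans (by simp)]
    refine Finset.sum_congr rfl fun i _ => ?_
    congr 1
    funext ω
    simp only [indicator, consChoice_mem_neverOne (show (nonemptyBins v).card ≠ 1 by omega)]
  · have h0 : v ≠ 0 := fun h0 => by
      rw [nonemptyBins_eq_empty_iff.2 h0] at h
      simp at h
    simp [h0, removeBall_ne_zero h]
  · by_cases h0 : v = 0
    · have : neverOne v = univ := by
        refine eq_univ_of_forall fun ω t => ?_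
        have h1 := total_state_le v ω t
        rw [total_eq_zero_iff.2 h0, Nat.le_zero, total_eq_zero_iff] at h1
        rw [nonemptyBins_eq_empty_iff.2 h1]
        simp
      simp only [this, indicator_univ, if_pos h0]
      simp
    · have : neverOne v = ∅ := by
        refine eq_empty_of_forall_notMem fun ω hω => hω 0 ?_
        have : nonemptyBins v ≠ ∅ := fun h => h0 (nonemptyBins_eq_empty_iff.1 h)
        have := Finset.card_ne_zero.2 (Finset.nonempty_iff_ne_empty.2 this)
        change (nonemptyBins v).card = 1
        omega
      simp [this, h0]

/-- If no later round has a unique non-empty bin, both stopping times take the default value `0`,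
and the equality fails when a ball is removed in the first round. -/
lemma remaining_consChoice {v : Fin k → ℕ} (h : (nonemptyBins v).card ≠ 1) {i : Fin k}
    {ω : ℕ → Fin k} (hω : ω ∉ neverOne (removeBall v i)) :
    remaining v (consChoice i ω) = remaining (removeBall v i) ω := by
  have hne : ∃ t, (nonemptyBins (state (removeBall v i) ω t)).card = 1 := by
    simpa [neverOne] using hω
  have hmem : (nonemptyBins (state (removeBall v i) ω (stopTime (removeBall v i) ω))).card = 1 :=
    Nat.sInf_mem hne
  have hst : stopTime v (consChoice i ω) = stopTime (removeBall v i) ω + 1 := by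
    refine le_antisymm (Nat.sInf_le ?_) ?_
    · simpa only [mem_ofPred_eq, state_consChoice] using hmem
    · refine le_csInf ⟨stopTime (removeBall v i) ω + 1, ?_⟩ ?_
      · simpa only [mem_ofPred_eq, state_consChoice] using hmem
      · rintro (_ | t) ht
        · exact absurd ht h
        · rw [mem_ofPred_eq, state_consChoice] at ht
          exact Nat.succ_le_succ (Nat.sInf_le ht)
  rw [remaining, hst, state_consChoice, remaining]

lemma f_eq_lastPhase [NeZero k] (v : Fin k → ℕ) : f v = lastPhase v := by
  refine eq_of_first_step (X := f) (Y := lastPhase) (fun v h => ?_)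
    (fun v h => card_mul_lastPhase h) (fun v h => ?_) v
  · unfold f
    rw [integral_choiceMeasure (g := fun ω => (remaining v ω : ℝ)) (C := total v)
      (measurable_from_top.comp (measurable_remaining v)) fun ω => by
        rw [Real.norm_natCast]
        exact_mod_cast total_state_le v ω _]
    refine Finset.sum_congr rfl fun i _ => integral_congr_ae ?_
    have h0 := measure_neverOne (removeBall_ne_zero h i)
    filter_upwards [measure_eq_zero_iff_ae_notMem.1 h0] with ω hω
    rw [remaining_consChoice (by omega) hω]
  · rw [lastPhase_of_card_le_one h]
    have hr : ∀ ω, remaining v ω = total v := by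
      intro ω
      by_cases h0 : v = 0
      · have h1 := total_state_le v ω (stopTime v ω)
        have h2 := total_eq_zero_iff.2 h0
        unfold remaining
        omega
      · have h1 : nonemptyBins v ≠ ∅ := fun h => h0 (nonemptyBins_eq_empty_iff.1 h)
        have h2 := Finset.card_ne_zero.2 (Finset.nonempty_iff_ne_empty.2 h1)
        have h3 : (nonemptyBins (state v ω 0)).card = 1 := by
          change (nonemptyBins v).card = 1
          omega
        have h4 : stopTime v ω = 0 := Nat.sInf_eq_zero.2 (Or.inl h3)
        rw [remaining, h4]
        rfl
    simp [f, hr]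

/-! ### Balanced assignments -/

/-- The number of bins above the lower value `m` is the excess of the total over `k * m`. -/
lemma card_filter_of_total {v : Fin k → ℕ} {m : ℕ} (hv : ∀ i, v i = m ∨ v i = m + 1) :
    total v = k * m + (Finset.univ.filter fun i => v i = m + 1).card := by
  have h : ∀ i, v i = m + if v i = m + 1 then 1 else 0 := fun i => by
    rcases hv i with h | h <;> simp [h]
  unfold total
  rw [Finset.sum_congr rfl fun i _ => h i, Finset.sum_add_distrib, Finset.card_filter]
  simp

lemma Balanced.exists_values [NeZero k] {v : Fin k → ℕ} (hv : Balanced v) :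
    ∃ m, (∀ i, v i = m ∨ v i = m + 1) ∧ ∃ i, v i = m := by
  obtain ⟨j, _, hj⟩ := Finset.exists_min_image Finset.univ v Finset.univ_nonempty
  refine ⟨v j, fun i => ?_, j, rfl⟩
  have h1 := hj i (Finset.mem_univ i)
  have h2 := abs_le.1 (hv i j)
  omega

lemma Balanced.exists_perm [NeZero k] {v w : Fin k → ℕ} (hv : Balanced v) (hw : Balanced w)
    (h : total v = total w) : ∃ σ : Equiv.Perm (Fin k), v = w ∘ σ := by
  obtain ⟨m, hm, i, hi⟩ := hv.exists_values
  obtain ⟨m', hm', i', hi'⟩ := hw.exists_values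
  have h1 := card_filter_of_total hm
  have h2 := card_filter_of_total hm'
  have lt : ∀ {u : Fin k → ℕ} {p : ℕ} {l : Fin k}, u l = p →
      (Finset.univ.filter fun i => u i = p + 1).card < k := by
    intro u p l hl
    refine (Finset.card_lt_univ_of_notMem (x := l) (by simp [hl])).trans_eq (Fintype.card_fin k)
  have h3 := lt hi
  have h4 := lt hi'
  have hmm : m = m' := by
    rw [h, h2] at h1
    rcases lt_trichotomy m m' with hlt | rfl | hlt
    · nlinarith [Nat.mul_le_mul_left k (Nat.succ_le_of_lt hlt)]
    · rfl
    · nlinarith [Nat.mul_le_mul_left k (Nat.succ_le_of_lt hlt)]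
  subst hmm
  have hcard : Fintype.card {i // v i = m + 1} = Fintype.card {i // w i = m + 1} := by
    rw [Fintype.card_subtype, Fintype.card_subtype]
    omega
  refine ⟨(Fintype.equivOfCardEq hcard).extendSubtype, funext fun l => ?_⟩
  by_cases hl : v l = m + 1
  · exact hl.trans ((Fintype.equivOfCardEq hcard).extendSubtype_mem l hl).symm
  · have h5 := (Fintype.equivOfCardEq hcard).extendSubtype_not_mem l hl
    exact ((hm l).resolve_right hl).trans ((hm' _).resolve_right h5).symm

lemma balanced_of_lastPhase_minimal [NeZero k] {v : Fin k → ℕ}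
    (h : ∀ w : Fin k → ℕ, total w = total v → lastPhase v ≤ lastPhase w) : Balanced v := by
  obtain ⟨i, _, hi⟩ := Finset.exists_max_image Finset.univ v Finset.univ_nonempty
  -- A bin with at least two balls fewer than a fullest one would allow an exchange.
  have key : ∀ j, v i ≤ v j + 1 := by
    intro j
    by_contra hj
    have hij : v j + 2 ≤ v i := by omega
    have hne : j ≠ i := by rintro rfl; omega
    refine absurd (lastPhase_exchange_lt (fun l => hi l (Finset.mem_univ l)) hij)
      (not_lt.2 (h _ ?_))
    unfold total
    rw [Finset.sum_update_of_mem (Finset.mem_univ j), Finset.sdiff_singleton_eq_erase,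
      Finset.sum_update_of_mem (Finset.mem_erase.2 ⟨hne.symm, Finset.mem_univ i⟩),
      ← Finset.add_sum_erase _ v (Finset.mem_univ j),
      ← Finset.add_sum_erase _ v (Finset.mem_erase.2 ⟨hne.symm, Finset.mem_univ i⟩),
      Finset.sdiff_singleton_eq_erase]
    omega
  intro a b
  have h1 := key a
  have h2 := key b
  have h3 := hi a (Finset.mem_univ a)
  have h4 := hi b (Finset.mem_univ b)
  rw [abs_le]
  omega

lemma lastPhase_minimal_iff [NeZero k] (v : Fin k → ℕ) :
    (∀ w : Fin k → ℕ, total w = total v → lastPhase v ≤ lastPhase w) ↔ Balanced v := by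
  refine ⟨balanced_of_lastPhase_minimal, fun hv w hw => ?_⟩
  -- Some assignment is minimal, it is balanced, and `v` is a permutation of it.
  obtain ⟨u, hu, hmin⟩ := Finset.exists_min_image
    (Finset.piAntidiag (Finset.univ : Finset (Fin k)) (total v)) lastPhase
    ⟨v, by simp [Finset.mem_piAntidiag, total]⟩
  have hut : total u = total v := (Finset.mem_piAntidiag.1 hu).1
  have hle : ∀ w : Fin k → ℕ, total w = total v → lastPhase u ≤ lastPhase w := fun w hw =>
    hmin w (Finset.mem_piAntidiag.2 ⟨hw, fun _ _ => Finset.mem_univ _⟩)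
  obtain ⟨σ, hσ⟩ := hv.exists_perm
    (balanced_of_lastPhase_minimal fun w hw => hle w (hw.trans hut)) hut.symm
  rw [hσ, lastPhase_comp_perm]
  exact hle w hw

end BallsBins

theorem theorem1 (n k : ℕ) [NeZero k] (v : Fin k → ℕ) (hv : ∑ i, v i = n) :
    ((∀ w : Fin k → ℕ, ∑ i, w i = n → BallsBins.f v ≤ BallsBins.f w) ↔
        BallsBins.Balanced v) ∧
    ((∀ w : Fin k → ℕ, ∑ i, w i = n → BallsBins.fNonempty v ≤ BallsBins.fNonempty w) ↔
        BallsBins.Balanced v) := by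
  subst hv
  simp only [BallsBins.f_eq_lastPhase, BallsBins.fNonempty_eq_lastPhase]
  exact ⟨BallsBins.lastPhase_minimal_iff v, BallsBins.lastPhase_minimal_iff v⟩
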